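/- Let $G,c>0$, let $\alpha\in C^2((0,\infty))$, and define the cumulative mass function $m:(0,\infty)\to\mathbb{R}$ by $$e^{2\alpha(r)} = 1-\frac{2Gm(r)}{c^2 r}\qquad (r>0).$$ On $\mathbb{R}\times(\mathbb{R}^3\setminus\{0\})$, with Cartesian coordinates $(t,x^1,x^2,x^3)$ and spherical coordinates $(t,r,\theta,\phi)$, consider the static spherically symmetric Lorentzian metric $$\mathbf g=-e^{2\alpha(r)}c^2\,dt^2+e^{-2\alpha(r)}\,dr^2+r^2\,(d\theta^2+\sin^2\theta\,d\phi^2),$$ with Levi-Civita connection $\nabla$, Einstein tensor $G^\mu{}_\nu=R^\mu{}_\nu-\tfrac12 R\,\delta^\mu{}_\nu$ and volume element $d\mathrm{vol}_{\mathbf g}$. Suppose that for some $\gamma>0$ $$m'(r)=O_1(r^{-1+\gamma})\qquad\text{as } r\downarrow 0,$$ that is, $r^{1-\gamma}m'(r)$ and $r^{2-\gamma}m''(r)$ are bounded as $r\downarrow0$. Then the twice-contracted second Bianchi identity holds weakly on all of $\mathbb{R}^4$: for every smooth compactly supported vector field $\psi$ on $\mathbb{R}^4$ the function $G^\mu{}_\nu\nabla_\mu\psi^\nu$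 is integrable with respect to $d\mathrm{vol}_{\mathbf g}$, and $$\int_{\mathbb{R}^4} G^\mu{}_\nu\,\nabla_\mu\psi^\nu\,d\mathrm{vol}_{\mathbf g}=0.$$ -/

import Mathlib

open scoped ContDiff Topology

namespace LorentzR4

noncomputable section

/-! ### Tensor calculus in the global coordinates `(t, x¹, x², x³)` of `ℝ⁴`

A (possibly singular) metric on `ℝ⁴` is given by its matrix of components at every point. -/

/-- The partial derivative `∂ᵢ f` at `x`. -/
def pderiv (i : Fin 4) (f : (Fin 4 → ℝ) → ℝ) (x : Fin 4 → ℝ) : ℝ :=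
  fderiv ℝ f x (Pi.single i 1)

/-- The Christoffel symbol `Γᵏᵢⱼ = ½ gᵏˡ (∂ᵢ gₗⱼ + ∂ⱼ gᵢₗ - ∂ₗ gᵢⱼ)` of the Levi-Civita
connection. -/
def christoffel (g : (Fin 4 → ℝ) → Matrix (Fin 4) (Fin 4) ℝ) (k i j : Fin 4)
    (x : Fin 4 → ℝ) : ℝ :=
  (1 / 2) * ∑ l, (g x)⁻¹ k l *
    (pderiv i (fun y => g y l j) x + pderiv j (fun y => g y i l) x
      - pderiv l (fun y => g y i j) x)

/-- The Ricci tensor `Rᵢⱼ = ∂ₖ Γᵏᵢⱼ - ∂ⱼ Γᵏᵢₖ + Γᵏₖₗ Γˡᵢⱼ - Γᵏⱼₗ Γˡᵢₖ`. -/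
def ricci (g : (Fin 4 → ℝ) → Matrix (Fin 4) (Fin 4) ℝ) (i j : Fin 4) (x : Fin 4 → ℝ) : ℝ :=
  ∑ k, (pderiv k (christoffel g k i j) x - pderiv j (christoffel g k i k) x
    + ∑ l, (christoffel g k k l x * christoffel g l i j x
      - christoffel g k j l x * christoffel g l i k x))

/-- The scalar curvature `R = gⁱʲ Rᵢⱼ`. -/
def scalarCurvature (g : (Fin 4 → ℝ) → Matrix (Fin 4) (Fin 4) ℝ) (x : Fin 4 → ℝ) : ℝ :=
  ∑ i, ∑ j, (g x)⁻¹ i j * ricci g i j x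

/-- The mixed Einstein tensor `Gᵘᵥ = Rᵘᵥ - ½ R δᵘᵥ`. -/
def einstein (g : (Fin 4 → ℝ) → Matrix (Fin 4) (Fin 4) ℝ) (μ ν : Fin 4) (x : Fin 4 → ℝ) : ℝ :=
  ∑ l, (g x)⁻¹ μ l * ricci g l ν x
    - (1 / 2) * scalarCurvature g x * (if μ = ν then 1 else 0)

/-- The covariant derivative `∇ᵤ ψᵛ = ∂ᵤ ψᵛ + Γᵛᵤₗ ψˡ` of a vector field `ψ`. -/
def covDeriv (g : (Fin 4 → ℝ) → Matrix (Fin 4) (Fin 4) ℝ) (ψ : (Fin 4 → ℝ) → (Fin 4 → ℝ))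
    (μ ν : Fin 4) (x : Fin 4 → ℝ) : ℝ :=
  pderiv μ (fun y => ψ y ν) x + ∑ l, christoffel g ν μ l x * ψ x l

/-- The density `√|det g|` of the volume element of `g` with respect to Lebesgue measure. -/
def volDensity (g : (Fin 4 → ℝ) → Matrix (Fin 4) (Fin 4) ℝ) (x : Fin 4 → ℝ) : ℝ :=
  Real.sqrt |(g x).det|

/-- The twice-contracted second Bianchi identity holds weakly on all of `ℝ⁴`: for every smooth
compactly supported vector field `ψ` on `ℝ⁴` the integral `∫ Gᵘᵥ ∇ᵤ ψᵛ dvol_g` exists as a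
Lebesgue integral and vanishes. -/
def WeakSecondBianchi (g : (Fin 4 → ℝ) → Matrix (Fin 4) (Fin 4) ℝ) : Prop :=
  ∀ ψ : (Fin 4 → ℝ) → (Fin 4 → ℝ), ContDiff ℝ ∞ ψ → HasCompactSupport ψ →
    MeasureTheory.Integrable
      (fun x => (∑ μ, ∑ ν, einstein g μ ν x * covDeriv g ψ μ ν x) * volDensity g x) ∧
    ∫ x, (∑ μ, ∑ ν, einstein g μ ν x * covDeriv g ψ μ ν x) * volDensity g x = 0

/-! ### Static spherically symmetric metrics -/

/-- The spatial radius `r = √((x¹)² + (x²)² + (x³)²)`; the coordinate `x 0` is the time `t`. -/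
def radius (x : Fin 4 → ℝ) : ℝ := Real.sqrt (x 1 ^ 2 + x 2 ^ 2 + x 3 ^ 2)

/-- The components of the one-form `dt`. -/
def dt (i : Fin 4) : ℝ := if i = 0 then 1 else 0

/-- The components of the one-form `dr = ∑ xⁱ dxⁱ / r` (for `r > 0`). -/
def dr (x : Fin 4 → ℝ) (i : Fin 4) : ℝ := if i = 0 then 0 else x i / radius x

/-- The components of the Euclidean metric `(dx¹)² + (dx²)² + (dx³)²` of space. -/
def euclid (i j : Fin 4) : ℝ := if i = j ∧ i ≠ 0 then 1 else 0

/-- The metric `-e^{2α(r)} c² dt² + e^{2β(r)} dr² + r² (dθ² + sin² θ dφ²)` for `r > 0`. Here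
`r² (dθ² + sin² θ dφ²) = (dx¹)² + (dx²)² + (dx³)² - dr²`. The values on the axis `r = 0`, a null
set off which the metric is defined, are irrelevant. -/
def staticMetric (c : ℝ) (α β : ℝ → ℝ) (x : Fin 4 → ℝ) : Matrix (Fin 4) (Fin 4) ℝ :=
  Matrix.of fun i j =>
    -(Real.exp (2 * α (radius x)) * c ^ 2) * (dt i * dt j)
      + Real.exp (2 * β (radius x)) * (dr x i * dr x j)
      + (euclid i j - dr x i * dr x j)

/-! ### Decay with derivatives -/

/-- `f(r) = O_k(r^a)` as `r ↓ 0`: the function `r^{j - a} f⁽ʲ⁾(r)` is bounded as `r ↓ 0` for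
`j = 0, …, k`. -/
def IsBigOWithDerivs (k : ℕ) (f : ℝ → ℝ) (a : ℝ) : Prop :=
  ∀ j ≤ k, (fun r : ℝ => r ^ ((j : ℝ) - a) * iteratedDeriv j f r) =O[𝓝[>] 0]
    (fun _ => (1 : ℝ))

end

end LorentzR4

/-! ### Gradients of functions of the coordinates, and radial functions. -/

namespace LorentzR4

/-! Put `f = exp (2α)` and `E = f - 1 + r f' = (r (f - 1))'`, so that `E = -(2G/c²) m'`. Off the
axis the Einstein tensor has `Gᵗₜ = Gʳᵣ = E/r²` and angular eigenvalue `E'/(2r)`, and `√|det g| = c`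
is constant. In Cartesian coordinates the connection terms in `Gᵘᵥ ∇ᵤψᵛ` cancel
(`einstein_contraction_staticMetric`), which leaves an expression linear in `∂ψ`.

With `Z = E/(2r²)` this expression is the ordinary divergence of `Z(r) · flux ψ`
(`einstein_contraction_eq_fluxDiv`), so only the axis could contribute to the integral. The decay of
`m'` makes `Z` and `r Z'` of size `r^(γ-3)`, which is locally integrable because space has dimension
three (`integrableOn_radius_rpow`).

Cutting `Z` off near the axis gives a `C¹` compactly supported field, whose divergence integrates to
zero (`integral_radial_flux_eq_zero`). The error from differentiating the cutoff is also bounded by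
a multiple of `r^(γ-3)`, uniformly in the cutoff, and tends to zero pointwise; dominated convergence
concludes (`integral_fluxDiv_eq_zero`). -/

/-- `f` has partial derivatives `v i` at `x`, as components of its Fréchet derivative. -/
def HasGrad (f : (Fin 4 → ℝ) → ℝ) (v : Fin 4 → ℝ) (x : Fin 4 → ℝ) : Prop :=
  HasFDerivAt f (∑ i, v i • ContinuousLinearMap.proj (R := ℝ) (φ := fun _ : Fin 4 => ℝ) i) x

namespace HasGrad

variable {f g : (Fin 4 → ℝ) → ℝ} {v w x : Fin 4 → ℝ}

theorem pderiv_eq (h : HasGrad f v x) (i : Fin 4) : pderiv i f x = v i := by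
  unfold pderiv
  rw [HasFDerivAt.fderiv h]
  simp [Pi.single_apply]

theorem of_differentiableAt (h : DifferentiableAt ℝ f x) :
    HasGrad f (fun i => pderiv i f x) x := by
  refine h.hasFDerivAt.congr_fderiv ?_
  ext j
  conv_lhs => rw [pi_eq_sum_univ' j, map_sum]
  simp only [map_smul, smul_eq_mul, sum_apply, smul_apply, ContinuousLinearMap.proj_apply, pderiv]
  refine Finset.sum_congr rfl fun i _ => ?_
  rw [mul_comm]

theorem congr_grad (h : HasGrad f v x) (e : ∀ i, v i = w i) : HasGrad f w x := by
  have : v = w := funext e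
  exact this ▸ h

theorem add (hf : HasGrad f v x) (hg : HasGrad g w x) :
    HasGrad (fun y => f y + g y) (fun i => v i + w i) x := by
  refine (HasFDerivAt.add hf hg).congr_fderiv ?_
  simp only [add_smul, Finset.sum_add_distrib]

theorem mul (hf : HasGrad f v x) (hg : HasGrad g w x) :
    HasGrad (fun y => f y * g y) (fun i => f x * w i + v i * g x) x := by
  refine (HasFDerivAt.mul hf hg).congr_fderiv ?_
  simp only [add_smul, Finset.sum_add_distrib, Finset.smul_sum, smul_smul, mul_comm]

theorem const (a : ℝ) : HasGrad (fun _ => a) (fun _ => 0) x := by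
  refine (hasFDerivAt_const a x).congr_fderiv ?_
  simp only [zero_smul, Finset.sum_const_zero]

theorem sum {f : Fin 4 → (Fin 4 → ℝ) → ℝ} {v : Fin 4 → Fin 4 → ℝ}
    (h : ∀ k, HasGrad (f k) (v k) x) :
    HasGrad (fun y => ∑ k, f k y) (fun i => ∑ k, v k i) x := by
  simp only [Fin.sum_univ_four]
  exact (((h 0).add (h 1)).add (h 2)).add (h 3)

theorem congr_of_eventuallyEq (h : HasGrad f v x) (e : g =ᶠ[𝓝 x] f) : HasGrad g v x :=
  HasFDerivAt.congr_of_eventuallyEq h e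

end HasGrad

/-- The spatial part of the position vector. -/
def spatial (x : Fin 4 → ℝ) (i : Fin 4) : ℝ := if i = 0 then 0 else x i

theorem radius_sq (x : Fin 4 → ℝ) : radius x ^ 2 = x 1 ^ 2 + x 2 ^ 2 + x 3 ^ 2 :=
  Real.sq_sqrt (by positivity)

theorem radius_nonneg (x : Fin 4 → ℝ) : 0 ≤ radius x := Real.sqrt_nonneg _

theorem continuous_radius : Continuous radius := by
  unfold radius; fun_prop

theorem eventually_radius_pos {x : Fin 4 → ℝ} (hx : 0 < radius x) :
    ∀ᶠ y in 𝓝 x, 0 < radius y :=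
  continuous_radius.continuousAt.eventually (lt_mem_nhds hx)

theorem hasGrad_coord (j : Fin 4) (x : Fin 4 → ℝ) :
    HasGrad (fun y => y j) (fun i => if i = j then 1 else 0) x := by
  refine HasFDerivAt.congr_fderiv
    (ContinuousLinearMap.proj (R := ℝ) (φ := fun _ : Fin 4 => ℝ) j).hasFDerivAt ?_
  simp

theorem hasGrad_spatial (j : Fin 4) (x : Fin 4 → ℝ) :
    HasGrad (fun y => spatial y j) (fun i => euclid i j) x := by
  by_cases h : j = 0
  · subst h
    simp only [spatial, if_true]
    refine (HasGrad.const 0).congr_grad fun i => ?_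
    simp only [euclid]
    rw [if_neg]; rintro ⟨rfl, h⟩; exact h rfl
  · simp only [spatial, if_neg h]
    refine (hasGrad_coord j x).congr_grad fun i => ?_
    simp only [euclid]
    by_cases h' : i = j
    · subst h'; simp [h]
    · simp [h']

theorem hasGrad_radial {ζ : ℝ → ℝ} {d : ℝ} {x : Fin 4 → ℝ} (hx : 0 < radius x)
    (h : HasDerivAt ζ d (radius x)) :
    HasGrad (fun y => ζ (radius y)) (fun i => d / radius x * spatial x i) x := by
  have hs : HasGrad (fun y => y 1 ^ 2 + y 2 ^ 2 + y 3 ^ 2) (fun i => 2 * spatial x i) x := by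
    simp only [pow_two]
    refine ((((hasGrad_coord 1 x).mul (hasGrad_coord 1 x)).add
      ((hasGrad_coord 2 x).mul (hasGrad_coord 2 x))).add
      ((hasGrad_coord 3 x).mul (hasGrad_coord 3 x))).congr_grad fun i => ?_
    fin_cases i <;> simp [spatial] <;> ring
  have hne : x 1 ^ 2 + x 2 ^ 2 + x 3 ^ 2 ≠ 0 := by
    rw [← radius_sq]; positivity
  have hr := (h.comp_hasFDerivAt x ((Real.hasDerivAt_sqrt hne).comp_hasFDerivAt x hs))
  refine hr.congr_fderiv ?_
  simp only [Finset.smul_sum, smul_smul]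
  refine Finset.sum_congr rfl fun i _ => ?_
  congr 1
  change d * (1 / (2 * radius x) * _) = _
  field_simp

/-! ### Curvature of the static metric -/

section Metric

variable {c : ℝ} {α f f₁ f₂ : ℝ → ℝ} {x : Fin 4 → ℝ}

/-- Since `dr = x/r`, the metric is a radial combination of `dt ⊗ dt`, `x ⊗ x` and the spatial
identity. Everything below stays polynomial in these blocks and reduces to identities between radial
coefficients. -/
theorem staticMetric_apply (hf : ∀ r, f r = Real.exp (2 * α r)) (hx : 0 < radius x)
    (i j : Fin 4) :
    staticMetric c α (fun r => -α r) x i j =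
      f (radius x) * (-c ^ 2 * (dt i * dt j))
        + ((f (radius x))⁻¹ - 1) / radius x ^ 2 * (spatial x i * spatial x j) + euclid i j := by
  have h : Real.exp (2 * -α (radius x)) = (f (radius x))⁻¹ := by
    rw [hf, ← Real.exp_neg]; ring_nf
  have hd : ∀ i, dr x i = spatial x i / radius x := by
    intro i; unfold dr spatial; split_ifs <;> simp
  simp only [staticMetric, Matrix.of_apply, h, hd, ← hf]
  generalize (f (radius x))⁻¹ = F
  field_simp
  ring

/-- The spatial block acts on the vector `x` as multiplication by `1 + k r²`, and these factors
multiply. -/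
theorem sum_block_mul (a b k q : ℝ) (x : Fin 4 → ℝ) (i j : Fin 4) :
    ∑ l, (a * (dt i * dt l) + k * (spatial x i * spatial x l) + euclid i l) *
      (b * (dt l * dt j) + q * (spatial x l * spatial x j) + euclid l j) =
    a * b * (dt i * dt j)
      + (k + q + k * q * radius x ^ 2) * (spatial x i * spatial x j) + euclid i j := by
  rw [radius_sq, Fin.sum_univ_four]
  fin_cases i <;> fin_cases j <;> simp [dt, spatial, euclid] <;> ring

theorem staticMetric_inv_apply (hc : c ≠ 0) (hf : ∀ r, f r = Real.exp (2 * α r))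
    (hx : 0 < radius x) (i j : Fin 4) :
    (staticMetric c α (fun r => -α r) x)⁻¹ i j =
      -(1 / (c ^ 2 * f (radius x))) * (dt i * dt j)
        + (f (radius x) - 1) / radius x ^ 2 * (spatial x i * spatial x j) + euclid i j := by
  have hf0 : f (radius x) ≠ 0 := by rw [hf]; exact (Real.exp_pos _).ne'
  have key : staticMetric c α (fun r => -α r) x *
      Matrix.of (fun i j => -(1 / (c ^ 2 * f (radius x))) * (dt i * dt j)
        + (f (radius x) - 1) / radius x ^ 2 * (spatial x i * spatial x j) + euclid i j) = 1 := by
    ext i j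
    have hone : (1 : Matrix (Fin 4) (Fin 4) ℝ) i j = dt i * dt j + euclid i j := by
      fin_cases i <;> fin_cases j <;> simp [dt, euclid]
    simp only [Matrix.mul_apply, staticMetric_apply hf hx, Matrix.of_apply, ← mul_assoc (f _)]
    have h := sum_block_mul (f (radius x) * -c ^ 2) (-(1 / (c ^ 2 * f (radius x))))
      (((f (radius x))⁻¹ - 1) / radius x ^ 2) ((f (radius x) - 1) / radius x ^ 2) x i j
    simp only [← mul_assoc] at h ⊢
    rw [h, hone]
    field_simp
    ring
  rw [Matrix.inv_eq_right_inv key]; rfl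

/-- The eigenvalues are `-c² f`, `1/f`, `1`, `1`; `f` drops out because `β = -α`. -/
theorem det_staticMetric (hf : ∀ r, f r = Real.exp (2 * α r)) (hx : 0 < radius x) :
    (staticMetric c α (fun r => -α r) x).det = -c ^ 2 := by
  have hf0 : f (radius x) ≠ 0 := by rw [hf]; exact (Real.exp_pos _).ne'
  rw [Matrix.det_succ_row_zero]
  simp only [Fin.sum_univ_four, Matrix.det_fin_three, Matrix.submatrix_apply,
    staticMetric_apply hf hx]
  have hs := radius_sq x
  have hs' : x 1 ^ 2 = radius x ^ 2 - x 2 ^ 2 - x 3 ^ 2 := by linarith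
  generalize radius x = r at *
  generalize f r = F at *
  simp [dt, spatial, euclid, Fin.succAbove]
  field_simp
  ring_nf
  simp only [hs']
  ring

end Metric

/-- The general static spherically symmetric form of Christoffel symbols. -/
def gammaForm (N L U V : ℝ) (x : Fin 4 → ℝ) (k i j : Fin 4) : ℝ :=
  N * (dt k * (dt i * spatial x j + spatial x i * dt j)) + L * (spatial x k * (dt i * dt j))
    + U * (spatial x k * (spatial x i * spatial x j)) + V * (spatial x k * euclid i j)

/-- The `l`-th partial derivative of `gammaForm` with radial coefficients, where `ζ₁` stands for
`ζ' / r` for each coefficient `ζ`. -/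
def gammaGrad (N L U V N₁ L₁ U₁ V₁ : ℝ) (x : Fin 4 → ℝ) (k i j l : Fin 4) : ℝ :=
  spatial x l * gammaForm N₁ L₁ U₁ V₁ x k i j
    + N * (dt k * (dt i * euclid l j + euclid l i * dt j)) + L * (euclid l k * (dt i * dt j))
    + U * (euclid l k * (spatial x i * spatial x j) + spatial x k * (euclid l i * spatial x j)
      + spatial x k * (spatial x i * euclid l j)) + V * (euclid l k * euclid i j)

theorem hasGrad_gammaForm {N L U V : ℝ → ℝ} {N' L' U' V' : ℝ} {x : Fin 4 → ℝ}
    (hx : 0 < radius x) (hN : HasDerivAt N N' (radius x)) (hL : HasDerivAt L L' (radius x))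
    (hU : HasDerivAt U U' (radius x)) (hV : HasDerivAt V V' (radius x)) (k i j : Fin 4) :
    HasGrad (fun y => gammaForm (N (radius y)) (L (radius y)) (U (radius y)) (V (radius y)) y k i j)
      (gammaGrad (N (radius x)) (L (radius x)) (U (radius x)) (V (radius x)) (N' / radius x)
        (L' / radius x) (U' / radius x) (V' / radius x) x k i j) x := by
  have C := fun a : ℝ => HasGrad.const (x := x) a
  have S := fun a => hasGrad_spatial a x
  unfold gammaForm
  refine (((((hasGrad_radial hx hN).mul ((C (dt k)).mul (((C (dt i)).mul (S j)).add
    ((S i).mul (C (dt j)))))).add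
    ((hasGrad_radial hx hL).mul ((S k).mul (C (dt i * dt j))))).add
    ((hasGrad_radial hx hU).mul ((S k).mul ((S i).mul (S j))))).add
    ((hasGrad_radial hx hV).mul ((S k).mul (C (euclid i j))))).congr_grad fun l => ?_
  simp only [gammaGrad, gammaForm]
  ring

/-- Here `b`, `q` are the coefficients of the inverse metric, `k` is the `x ⊗ x` coefficient of the
metric, and `a₁`, `k₁` are the radial derivatives of its coefficients divided by `r`. -/
theorem sum_christoffel_eq (b q a₁ k k₁ : ℝ) (x : Fin 4 → ℝ) (m i j : Fin 4) :
    (1 / 2) * ∑ l, (b * (dt m * dt l) + q * (spatial x m * spatial x l) + euclid m l) *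
      ((a₁ * (spatial x i * (dt l * dt j)) + k₁ * (spatial x i * (spatial x l * spatial x j))
          + k * (spatial x l * euclid i j + euclid i l * spatial x j))
        + (a₁ * (spatial x j * (dt i * dt l)) + k₁ * (spatial x j * (spatial x i * spatial x l))
          + k * (spatial x i * euclid j l + euclid j i * spatial x l))
        - (a₁ * (spatial x l * (dt i * dt j)) + k₁ * (spatial x l * (spatial x i * spatial x j))
          + k * (spatial x i * euclid l j + euclid l i * spatial x j))) =
    gammaForm (b * a₁ / 2) (-(a₁ / 2) * (1 + q * radius x ^ 2)) (k₁ / 2 * (1 + q * radius x ^ 2))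
      (k * (1 + q * radius x ^ 2)) x m i j := by
  rw [radius_sq, Fin.sum_univ_four]
  unfold gammaForm
  fin_cases m <;> fin_cases i <;> fin_cases j <;> simp [dt, spatial, euclid] <;> ring

/-- `T` is the coefficient of the contracted symbol `Γᵏₖₗ = T xˡ`, and `T₁` stands for `T'/r`; the
term `2 * U` comes from differentiating `r²`. -/
theorem sum_ricci_eq (N L U V N₁ L₁ U₁ V₁ : ℝ) (x : Fin 4 → ℝ) (i j : Fin 4) {T T₁ : ℝ}
    (hT : T = N + U * radius x ^ 2 + V) (hT₁ : T₁ = N₁ + U₁ * radius x ^ 2 + 2 * U + V₁) :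
    ∑ k, (gammaGrad N L U V N₁ L₁ U₁ V₁ x k i j k - gammaGrad N L U V N₁ L₁ U₁ V₁ x k i k j
      + ∑ l, (gammaForm N L U V x k k l * gammaForm N L U V x l i j
        - gammaForm N L U V x k j l * gammaForm N L U V x l i k)) =
    (3 * L + L₁ * radius x ^ 2 + T * L * radius x ^ 2 - 2 * N * L * radius x ^ 2) * (dt i * dt j)
      + (5 * U + U₁ * radius x ^ 2 - T₁ + T * radius x ^ 2 * U - N ^ 2
        - (U * radius x ^ 2 + V) ^ 2) * (spatial x i * spatial x j)
      + (3 * V + V₁ * radius x ^ 2 - T + T * radius x ^ 2 * V) * euclid i j := by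
  subst hT hT₁
  simp only [radius_sq, Fin.sum_univ_four]
  unfold gammaGrad gammaForm
  fin_cases i <;> fin_cases j <;> simp [dt, spatial, euclid] <;> ring

theorem ricci_of_christoffel_eq {g : (Fin 4 → ℝ) → Matrix (Fin 4) (Fin 4) ℝ} {N L U V : ℝ → ℝ}
    {N' L' U' V' T T₁ : ℝ} {x : Fin 4 → ℝ} (hx : 0 < radius x)
    (hΓ : ∀ y, 0 < radius y → ∀ k i j, christoffel g k i j y =
      gammaForm (N (radius y)) (L (radius y)) (U (radius y)) (V (radius y)) y k i j)
    (hN : HasDerivAt N N' (radius x)) (hL : HasDerivAt L L' (radius x))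
    (hU : HasDerivAt U U' (radius x)) (hV : HasDerivAt V V' (radius x))
    (hT : T = N (radius x) + U (radius x) * radius x ^ 2 + V (radius x))
    (hT₁ : T₁ = N' / radius x + U' / radius x * radius x ^ 2 + 2 * U (radius x) + V' / radius x)
    (i j : Fin 4) :
    ricci g i j x =
      (3 * L (radius x) + L' / radius x * radius x ^ 2 + T * L (radius x) * radius x ^ 2
          - 2 * N (radius x) * L (radius x) * radius x ^ 2) * (dt i * dt j)
        + (5 * U (radius x) + U' / radius x * radius x ^ 2 - T₁
          + T * radius x ^ 2 * U (radius x) - N (radius x) ^ 2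
          - (U (radius x) * radius x ^ 2 + V (radius x)) ^ 2) * (spatial x i * spatial x j)
        + (3 * V (radius x) + V' / radius x * radius x ^ 2 - T
          + T * radius x ^ 2 * V (radius x)) * euclid i j := by
  have hd := fun k i j l => ((hasGrad_gammaForm hx hN hL hU hV k i j).congr_of_eventuallyEq
    ((eventually_radius_pos hx).mono fun y hy => hΓ y hy k i j)).pderiv_eq l
  unfold ricci
  simp only [hd, hΓ x hx]
  exact sum_ricci_eq _ _ _ _ _ _ _ _ x i j hT hT₁

theorem sum_scalarCurvature_eq (b q p y e : ℝ) (x : Fin 4 → ℝ) :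
    ∑ i, ∑ j, (b * (dt i * dt j) + q * (spatial x i * spatial x j) + euclid i j) *
      (p * (dt i * dt j) + y * (spatial x i * spatial x j) + e * euclid i j) =
    b * p + y * (1 + q * radius x ^ 2) * radius x ^ 2 + e * (3 + q * radius x ^ 2) := by
  simp only [radius_sq, Fin.sum_univ_four]
  simp [dt, spatial, euclid]
  ring

theorem sum_einstein_eq (b q p y e R : ℝ) (x : Fin 4 → ℝ) (i j : Fin 4) :
    ∑ l, (b * (dt i * dt l) + q * (spatial x i * spatial x l) + euclid i l) *
      (p * (dt l * dt j) + y * (spatial x l * spatial x j) + e * euclid l j)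
      - (1 / 2) * R * (if i = j then 1 else 0) =
    (b * p - R / 2) * (dt i * dt j)
      + (y * (1 + q * radius x ^ 2) + e * q) * (spatial x i * spatial x j)
      + (e - R / 2) * euclid i j := by
  simp only [radius_sq, Fin.sum_univ_four]
  fin_cases i <;> fin_cases j <;> simp [dt, spatial, euclid] <;> ring

/-- The bracket before `x 1 * v 1 + ⋯` collects the entire contribution of the connection. -/
theorem sum_contraction_eq (A Y B N L U V : ℝ) (x : Fin 4 → ℝ) (D : Fin 4 → Fin 4 → ℝ)
    (v : Fin 4 → ℝ) :
    ∑ μ, ∑ ν, (A * (dt μ * dt ν) + Y * (spatial x μ * spatial x ν) + B * euclid μ ν) *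
      (D μ ν + ∑ l, gammaForm N L U V x ν μ l * v l) =
    A * D 0 0 + Y * (∑ μ, ∑ ν, spatial x μ * spatial x ν * D μ ν) + B * (D 1 1 + D 2 2 + D 3 3)
      + (A * N + (B + Y * radius x ^ 2) * (U * radius x ^ 2 + V))
        * (x 1 * v 1 + x 2 * v 2 + x 3 * v 3) := by
  simp only [radius_sq, Fin.sum_univ_four]
  unfold gammaForm
  simp [dt, spatial, euclid]
  ring

section Curvature

variable {c : ℝ} {α f f₁ f₂ : ℝ → ℝ} {x : Fin 4 → ℝ}

theorem pderiv_staticMetric (hf : ∀ r, f r = Real.exp (2 * α r))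
    (h₁ : ∀ r, 0 < r → HasDerivAt f (f₁ r) r) (hx : 0 < radius x) (i j l : Fin 4) :
    pderiv l (fun y => staticMetric c α (fun r => -α r) y i j) x =
      -c ^ 2 * f₁ (radius x) / radius x * (spatial x l * (dt i * dt j))
        + (-f₁ (radius x) / f (radius x) ^ 2 / radius x ^ 2
            - 2 * ((f (radius x))⁻¹ - 1) / radius x ^ 3) / radius x
          * (spatial x l * (spatial x i * spatial x j))
        + ((f (radius x))⁻¹ - 1) / radius x ^ 2
          * (spatial x i * euclid l j + euclid l i * spatial x j) := by
  have hf0 : f (radius x) ≠ 0 := by rw [hf]; exact (Real.exp_pos _).ne'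
  have hk : HasDerivAt (fun r => ((f r)⁻¹ - 1) / r ^ 2)
      (-f₁ (radius x) / f (radius x) ^ 2 / radius x ^ 2
        - 2 * ((f (radius x))⁻¹ - 1) / radius x ^ 3) (radius x) := by
    refine HasDerivAt.congr_deriv ((((h₁ _ hx).inv hf0).sub_const 1).div
      (hasDerivAt_pow 2 (radius x))
      (by positivity)) ?_
    simp only [Pi.inv_apply]
    field_simp
    push_cast
    ring
  have hg := ((hasGrad_radial hx (h₁ _ hx)).mul (HasGrad.const (-c ^ 2 * (dt i * dt j)))).add
    ((hasGrad_radial hx hk).mul ((hasGrad_spatial i x).mul (hasGrad_spatial j x))) |>.add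
    (HasGrad.const (euclid i j))
  have he : (fun y => staticMetric c α (fun r => -α r) y i j) =ᶠ[𝓝 x] _ :=
    (eventually_radius_pos hx).mono fun y hy => staticMetric_apply hf hy i j
  rw [(hg.congr_of_eventuallyEq he).pderiv_eq l]
  ring

theorem christoffel_staticMetric (hc : c ≠ 0) (hf : ∀ r, f r = Real.exp (2 * α r))
    (h₁ : ∀ r, 0 < r → HasDerivAt f (f₁ r) r) (hx : 0 < radius x) (k i j : Fin 4) :
    christoffel (staticMetric c α (fun r => -α r)) k i j x =
      gammaForm (f₁ (radius x) / (2 * f (radius x) * radius x))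
        (c ^ 2 * f (radius x) * f₁ (radius x) / (2 * radius x))
        (-f₁ (radius x) / (2 * f (radius x) * radius x ^ 3) - (1 - f (radius x)) / radius x ^ 4)
        ((1 - f (radius x)) / radius x ^ 2) x k i j := by
  have hf0 : f (radius x) ≠ 0 := by rw [hf]; exact (Real.exp_pos _).ne'
  unfold christoffel
  simp only [pderiv_staticMetric hf h₁ hx, staticMetric_inv_apply hc hf hx]
  rw [sum_christoffel_eq]
  congr 1 <;> field_simp <;> ring

/-- The mixed Einstein tensor of a static metric, with `f = exp (2 α)`. -/
theorem einstein_staticMetric (hc : c ≠ 0) (hf : ∀ r, f r = Real.exp (2 * α r))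
    (h₁ : ∀ r, 0 < r → HasDerivAt f (f₁ r) r) (h₂ : ∀ r, 0 < r → HasDerivAt f₁ (f₂ r) r)
    (hx : 0 < radius x) (i j : Fin 4) :
    einstein (staticMetric c α (fun r => -α r)) i j x =
      (f (radius x) - 1 + radius x * f₁ (radius x)) / radius x ^ 2 * (dt i * dt j)
        + ((f (radius x) - 1 + radius x * f₁ (radius x)) / radius x ^ 4
            - (2 * f₁ (radius x) + radius x * f₂ (radius x)) / (2 * radius x ^ 3))
          * (spatial x i * spatial x j)
        + (2 * f₁ (radius x) + radius x * f₂ (radius x)) / (2 * radius x) * euclid i j := by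
  have hf0 : f (radius x) ≠ 0 := by rw [hf]; exact (Real.exp_pos _).ne'
  have hF := h₁ _ hx
  have hF₁ := h₂ _ hx
  have hr := hasDerivAt_id' (radius x)
  have hN : HasDerivAt (fun r => f₁ r / (2 * f r * r))
      (f₂ (radius x) / (2 * f (radius x) * radius x)
        - f₁ (radius x) ^ 2 / (2 * f (radius x) ^ 2 * radius x)
        - f₁ (radius x) / (2 * f (radius x) * radius x ^ 2)) (radius x) := by
    refine HasDerivAt.congr_deriv (hF₁.div ((hF.const_mul 2).mul hr)
      (by positivity)) ?_
    field_simp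
    ring
  have hL : HasDerivAt (fun r => c ^ 2 * f r * f₁ r / (2 * r))
      (c ^ 2 * (f₁ (radius x) ^ 2 + f (radius x) * f₂ (radius x)) / (2 * radius x)
        - c ^ 2 * f (radius x) * f₁ (radius x) / (2 * radius x ^ 2)) (radius x) := by
    refine HasDerivAt.congr_deriv (((hF.const_mul (c ^ 2)).mul hF₁).div (hr.const_mul 2)
      (by positivity)) ?_
    simp only [Pi.mul_apply]
    field_simp
  have hV : HasDerivAt (fun r => (1 - f r) / r ^ 2)
      (-f₁ (radius x) / radius x ^ 2 - 2 * (1 - f (radius x)) / radius x ^ 3) (radius x) := by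
    refine HasDerivAt.congr_deriv ((hF.const_sub 1).div (hasDerivAt_pow 2 (radius x))
      (by positivity)) ?_
    field_simp
    push_cast
    ring
  have hU : HasDerivAt (fun r => -f₁ r / (2 * f r * r ^ 3) - (1 - f r) / r ^ 4)
      (-f₂ (radius x) / (2 * f (radius x) * radius x ^ 3)
        + f₁ (radius x) ^ 2 / (2 * f (radius x) ^ 2 * radius x ^ 3)
        + 3 * f₁ (radius x) / (2 * f (radius x) * radius x ^ 4)
        + f₁ (radius x) / radius x ^ 4 + 4 * (1 - f (radius x)) / radius x ^ 5) (radius x) := by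
    refine HasDerivAt.congr_deriv ((hF₁.neg.div
      ((hF.const_mul 2).mul (hasDerivAt_pow 3 (radius x)))
      (by simp only [Pi.mul_apply]; positivity)).sub
      ((hF.const_sub 1).div (hasDerivAt_pow 4 (radius x)) (by positivity))) ?_
    simp only [Pi.mul_apply, Pi.neg_apply]
    field_simp
    push_cast
    ring
  -- `Γᵏₖₗ = ∂ₗ log √|det g|` vanishes because the determinant is constant.
  have hRic := ricci_of_christoffel_eq (T := 0) (T₁ := 0) hx
    (fun y hy k i j => christoffel_staticMetric hc hf h₁ hy k i j) hN hL hU hV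
    (by field_simp; ring) (by field_simp; ring)
  unfold einstein scalarCurvature
  simp only [hRic, staticMetric_inv_apply hc hf hx]
  rw [sum_scalarCurvature_eq, sum_einstein_eq]
  congr 1
  · congr 1
    · congr 1; field_simp; ring
    · congr 1; field_simp; ring
  · congr 1; field_simp; ring

theorem einstein_contraction_staticMetric (hc : c ≠ 0) (hf : ∀ r, f r = Real.exp (2 * α r))
    (h₁ : ∀ r, 0 < r → HasDerivAt f (f₁ r) r) (h₂ : ∀ r, 0 < r → HasDerivAt f₁ (f₂ r) r)
    (hx : 0 < radius x) (ψ : (Fin 4 → ℝ) → (Fin 4 → ℝ)) :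
    ∑ μ, ∑ ν, einstein (staticMetric c α (fun r => -α r)) μ ν x *
        covDeriv (staticMetric c α (fun r => -α r)) ψ μ ν x =
      (f (radius x) - 1 + radius x * f₁ (radius x)) / radius x ^ 2
          * pderiv 0 (fun y => ψ y 0) x
        + ((f (radius x) - 1 + radius x * f₁ (radius x)) / radius x ^ 4
            - (2 * f₁ (radius x) + radius x * f₂ (radius x)) / (2 * radius x ^ 3))
          * (∑ μ, ∑ ν, spatial x μ * spatial x ν * pderiv μ (fun y => ψ y ν) x)
        + (2 * f₁ (radius x) + radius x * f₂ (radius x)) / (2 * radius x)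
          * (pderiv 1 (fun y => ψ y 1) x + pderiv 2 (fun y => ψ y 2) x
            + pderiv 3 (fun y => ψ y 3) x) := by
  have hf0 : f (radius x) ≠ 0 := by rw [hf]; exact (Real.exp_pos _).ne'
  unfold covDeriv
  simp only [einstein_staticMetric hc hf h₁ h₂ hx, christoffel_staticMetric hc hf h₁ hx]
  rw [sum_contraction_eq _ _ _ _ _ _ _ x (fun μ ν => pderiv μ (fun y => ψ y ν) x)]
  -- The connection term vanishes: `B + Y r² = Gʳᵣ = Gᵗₜ = A`, while `U r² + V = -N`.
  rw [add_eq_left]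
  convert zero_mul _ using 2
  field_simp
  ring

end Curvature

open MeasureTheory Set

/-! ### Integrability of powers of the radius -/

theorem integrable_indicator_abs_rpow {s : ℝ} (hs : -1 < s) {R : ℝ} (hR : 0 ≤ R) :
    Integrable ((Icc (-R) R).indicator fun t : ℝ => |t| ^ s) := by
  rw [integrable_indicator_iff measurableSet_Icc,
    ← intervalIntegrable_iff_integrableOn_Icc_of_le (by linarith)]
  have h : IntervalIntegrable (fun t : ℝ => |t| ^ s) volume 0 R := by
    refine (intervalIntegral.intervalIntegrable_rpow' hs (a := 0) (b := R)).congr ?_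
    intro t ht
    rw [uIoc_of_le hR] at ht
    simp [abs_of_pos ht.1]
  refine IntervalIntegrable.trans (b := 0) ?_ h
  have := (IntervalIntegrable.iff_comp_neg (f := fun t : ℝ => |t| ^ s)).1 h
  simpa using this.symm

theorem ae_coord_ne_zero (i : Fin 4) : ∀ᵐ x : Fin 4 → ℝ, x i ≠ 0 := by
  rw [ae_iff]
  simp only [ne_eq, not_not]
  exact Measure.pi_hyperplane (fun _ : Fin 4 => (volume : Measure ℝ)) i 0

theorem abs_spatial_le_radius (x : Fin 4 → ℝ) (i : Fin 4) : |spatial x i| ≤ radius x := by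
  refine abs_le_of_sq_le_sq (?_ : _ ≤ _) (radius_nonneg x)
  rw [radius_sq]
  fin_cases i <;> simp [spatial] <;>
    nlinarith [sq_nonneg (x 1), sq_nonneg (x 2), sq_nonneg (x 3)]

theorem radius_pos_of_ne {x : Fin 4 → ℝ} (h : x 1 ≠ 0) : 0 < radius x :=
  (abs_pos.2 h).trans_le (by simpa [spatial] using abs_spatial_le_radius x 1)

theorem ae_radius_pos : ∀ᵐ x : Fin 4 → ℝ, 0 < radius x :=
  (ae_coord_ne_zero 1).mono fun _ h => radius_pos_of_ne h

/-- The exponent is negative and `r ≥ |xⁱ|`, so `r^(γ-3)` is at most the product of the three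
functions `|xⁱ|^((γ-3)/3)`. Each is locally integrable on the line because its exponent exceeds
`-1`, and Fubini replaces polar coordinates. -/
theorem integrableOn_radius_rpow {γ : ℝ} (h0 : 0 < γ) (h1 : γ ≤ 1) {K : Set (Fin 4 → ℝ)}
    (hK : IsCompact K) : IntegrableOn (fun x => radius x ^ (γ - 3)) K := by
  obtain ⟨R, hR0, hR⟩ := hK.isBounded.exists_pos_norm_le
  have hs : -1 < (γ - 3) / 3 := by linarith
  let φ : Fin 4 → ℝ → ℝ := fun i => (Icc (-R) R).indicator
    (fun t : ℝ => |t| ^ (if i = 0 then 0 else (γ - 3) / 3))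
  have hφ : ∀ i, Integrable (φ i) := fun i =>
    integrable_indicator_abs_rpow (by split_ifs <;> linarith) hR0.le
  have hint : Integrable (fun x : Fin 4 → ℝ => ∏ i, φ i (x i)) := Integrable.fintype_prod hφ
  refine Integrable.mono' hint.integrableOn
    (continuous_radius.measurable.pow_const _).aestronglyMeasurable ?_
  filter_upwards [ae_restrict_mem hK.measurableSet, ae_restrict_of_ae (ae_coord_ne_zero 1),
    ae_restrict_of_ae (ae_coord_ne_zero 2), ae_restrict_of_ae (ae_coord_ne_zero 3)]
    with x hx h1 h2 h3
  have hr := radius_pos_of_ne h1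
  have hmem : ∀ i, x i ∈ Icc (-R) R := fun i => by
    exact abs_le.1 <| (norm_le_pi_norm x i).trans (hR x hx)
  have hle : ∀ i : Fin 4, i ≠ 0 → x i ≠ 0 →
      radius x ^ ((γ - 3) / 3) ≤ |x i| ^ ((γ - 3) / 3) := fun i hi hxi => by
    refine Real.rpow_le_rpow_of_nonpos (abs_pos.2 hxi) ?_ (by linarith)
    simpa [spatial, hi] using abs_spatial_le_radius x i
  have e : radius x ^ (γ - 3) = radius x ^ ((γ - 3) / 3) * radius x ^ ((γ - 3) / 3)
      * radius x ^ ((γ - 3) / 3) := by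
    rw [← Real.rpow_add hr, ← Real.rpow_add hr]; ring_nf
  rw [Real.norm_of_nonneg (by positivity), e]
  simp only [φ, indicator_of_mem (hmem _), Fin.prod_univ_four]
  simp only [if_true, Real.rpow_zero, one_mul, Fin.reduceEq, if_false]
  exact mul_le_mul (mul_le_mul (hle 1 (by decide) h1) (hle 2 (by decide) h2) (by positivity)
    (by positivity)) (hle 3 (by decide) h3) (by positivity) (by positivity)

/-! ### Bounds on punctured intervals -/

/-- The asymptotic bound covers `(0, δ)`, and compactness covers `[δ, R]`. -/
theorem exists_abs_le_of_isBigO_one {h : ℝ → ℝ} (hc : ContinuousOn h (Ioi 0))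
    (hO : h =O[𝓝[>] 0] (fun _ => (1 : ℝ))) (R : ℝ) :
    ∃ C, 0 ≤ C ∧ ∀ r, 0 < r → r ≤ R → |h r| ≤ C := by
  obtain ⟨C₁, hC₁⟩ := hO.bound
  obtain ⟨δ, hδ, hsub⟩ := mem_nhdsGT_iff_exists_Ioo_subset.1 hC₁
  have hδ : 0 < δ := hδ
  obtain ⟨C₂, hC₂⟩ := (isCompact_Icc (a := δ) (b := R)).exists_bound_of_continuousOn
    (hc.mono fun r hr => hδ.trans_le hr.1)
  refine ⟨max 0 (max C₁ C₂), le_max_left _ _, fun r h0 hR => ?_⟩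
  rcases lt_or_ge r δ with hr | hr
  · have : ‖h r‖ ≤ C₁ * ‖(1 : ℝ)‖ := hsub ⟨h0, hr⟩
    rw [norm_one, mul_one] at this
    exact this.trans ((le_max_left _ _).trans (le_max_right _ _))
  · exact (hC₂ r ⟨hr, hR⟩).trans ((le_max_right _ _).trans (le_max_right _ _))

theorem IsBigOWithDerivs.mono {k : ℕ} {f : ℝ → ℝ} {a b : ℝ} (h : IsBigOWithDerivs k f a)
    (hba : b ≤ a) : IsBigOWithDerivs k f b := by
  intro j hj
  have h1 : (fun r : ℝ => r ^ (a - b)) =O[𝓝[>] 0] (fun _ => (1 : ℝ)) := by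
    refine Asymptotics.IsBigO.of_bound 1 ?_
    filter_upwards [Ioo_mem_nhdsGT (zero_lt_one' ℝ)] with r hr
    rw [norm_one, mul_one, Real.norm_of_nonneg (Real.rpow_nonneg hr.1.le _)]
    exact Real.rpow_le_one hr.1.le hr.2.le (by linarith)
  refine Asymptotics.IsBigO.congr' (h1.mul (h j hj)) ?_ (by simp)
  filter_upwards [self_mem_nhdsWithin] with r hr
  rw [← mul_assoc, ← Real.rpow_add hr]
  ring_nf

/-! ### Divergence of compactly supported fields -/

theorem integrable_pderiv {u : (Fin 4 → ℝ) → ℝ} (hu : ContDiff ℝ 1 u) (hs : HasCompactSupport u)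
    (i : Fin 4) : Integrable (pderiv i u) :=
  ((hu.continuous_fderiv one_ne_zero).clm_apply continuous_const).integrable_of_hasCompactSupport
    (hs.fderiv_apply (𝕜 := ℝ) _)

theorem integral_pderiv_eq_zero {u : (Fin 4 → ℝ) → ℝ} (hu : ContDiff ℝ 1 u)
    (hs : HasCompactSupport u) (i : Fin 4) : ∫ x, pderiv i u x = 0 := by
  have h := integral_mul_fderiv_eq_neg_fderiv_mul_of_integrable (μ := volume)
    (f := fun _ : Fin 4 → ℝ => (1 : ℝ)) (g := u) (v := Pi.single i 1) (by simp)
    (by simpa [pderiv] using! integrable_pderiv hu hs i)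
    (by simpa using hu.continuous.integrable_of_hasCompactSupport hs)
    (fun _ _ => differentiableAt_const _) (fun x _ => hu.differentiable one_ne_zero x)
  simpa [pderiv] using h

theorem contDiff_pderiv {u : (Fin 4 → ℝ) → ℝ} (hu : ContDiff ℝ ∞ u) (i : Fin 4) :
    ContDiff ℝ ∞ (pderiv i u) :=
  (hu.fderiv_right (m := ∞) (by simp)).clm_apply contDiff_const

theorem pderiv_comm {u : (Fin 4 → ℝ) → ℝ} (hu : ContDiff ℝ ∞ u) (i j : Fin 4)
    (x : Fin 4 → ℝ) : pderiv i (pderiv j u) x = pderiv j (pderiv i u) x := by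
  have hd : DifferentiableAt ℝ (fderiv ℝ u) x :=
    (hu.fderiv_right (m := ∞) (by simp)).differentiable (by simp) x
  have key : ∀ i j, pderiv i (pderiv j u) x =
      fderiv ℝ (fderiv ℝ u) x (Pi.single i 1) (Pi.single j 1) := fun i j => by
    have : HasFDerivAt (pderiv j u) _ x :=
      hd.hasFDerivAt.clm_apply (hasFDerivAt_const (Pi.single j (1 : ℝ) : Fin 4 → ℝ) x)
    rw [pderiv, this.fderiv]
    simp
  rw [key, key]
  exact (hu.contDiffAt.isSymmSndFDerivAt
    (by simpa using WithTop.coe_le_coe.2 (le_top : (2 : ℕ∞) ≤ ⊤))).eq _ _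

theorem pderiv_eq_zero_of_notMem_tsupport {u : (Fin 4 → ℝ) → ℝ} {x : Fin 4 → ℝ}
    (hx : x ∉ tsupport u) (i : Fin 4) : pderiv i u x = 0 := by
  rw [pderiv, fderiv_of_notMem_tsupport (𝕜 := ℝ) hx]; simp

/-! ### The flux field and its divergence. -/

/-- The spatial divergence of a vector field. -/
noncomputable def spatialDiv (ψ : (Fin 4 → ℝ) → (Fin 4 → ℝ)) (x : Fin 4 → ℝ) : ℝ :=
  ∑ i, (1 - dt i) * pderiv i (fun y => ψ y i) x

/-- The quadratic form `∑ xᵘ xᵛ ∂ᵤ ψᵛ` over the spatial indices. -/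
noncomputable def radialDeriv (ψ : (Fin 4 → ℝ) → (Fin 4 → ℝ)) (x : Fin 4 → ℝ) : ℝ :=
  ∑ μ, ∑ ν, spatial x μ * spatial x ν * pderiv μ (fun y => ψ y ν) x

/-- The vector field with components `2 ψ⁰` and `xᵏ div ψ - ∑ xᵘ ∂ᵤ ψᵏ`, where `div` and the sum
are spatial. -/
noncomputable def flux (ψ : (Fin 4 → ℝ) → (Fin 4 → ℝ)) (k : Fin 4) (x : Fin 4 → ℝ) : ℝ :=
  dt k * (2 * ψ x 0) + spatial x k * spatialDiv ψ x
    + (dt k - 1) * ∑ μ, spatial x μ * pderiv μ (fun y => ψ y k) x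

/-- The divergence of `flux ψ` multiplied by the radial function `ζ`, off the axis. -/
noncomputable def fluxDiv (ψ : (Fin 4 → ℝ) → (Fin 4 → ℝ)) (ζ : ℝ → ℝ) (x : Fin 4 → ℝ) : ℝ :=
  ζ (radius x) * (2 * pderiv 0 (fun y => ψ y 0) x + 2 * spatialDiv ψ x)
    + deriv ζ (radius x) / radius x * (radius x ^ 2 * spatialDiv ψ x - radialDeriv ψ x)

section Flux

variable {ψ : (Fin 4 → ℝ) → (Fin 4 → ℝ)} {x : Fin 4 → ℝ}

theorem contDiff_spatial (i : Fin 4) : ContDiff ℝ ∞ (fun x => spatial x i) := by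
  unfold spatial
  split_ifs <;> fun_prop

theorem contDiff_pderiv_comp (hψ : ContDiff ℝ ∞ ψ) (i j : Fin 4) :
    ContDiff ℝ ∞ (pderiv i (fun y => ψ y j)) :=
  contDiff_pderiv (contDiff_pi.1 hψ j) i

theorem contDiff_spatialDiv (hψ : ContDiff ℝ ∞ ψ) : ContDiff ℝ ∞ (spatialDiv ψ) :=
  ContDiff.sum fun i _ => contDiff_const.mul (contDiff_pderiv_comp hψ i i)

theorem contDiff_flux (hψ : ContDiff ℝ ∞ ψ) (k : Fin 4) : ContDiff ℝ ∞ (flux ψ k) :=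
  ((contDiff_const.mul (contDiff_const.mul (contDiff_pi.1 hψ 0))).add
    ((contDiff_spatial k).mul (contDiff_spatialDiv hψ))).add
    (contDiff_const.mul (ContDiff.sum fun i _ =>
      (contDiff_spatial i).mul (contDiff_pderiv_comp hψ i k)))

theorem pderiv_comp_eq_zero (hx : x ∉ tsupport ψ) (i j : Fin 4) :
    pderiv i (fun y => ψ y j) x = 0 := by
  refine pderiv_eq_zero_of_notMem_tsupport (fun h => hx ?_) i
  exact closure_mono (fun y (hy : ψ y j ≠ 0) (h0 : ψ y = 0) => hy (by rw [h0]; rfl)) h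

theorem spatialDiv_eq_zero (hx : x ∉ tsupport ψ) : spatialDiv ψ x = 0 := by
  simp [spatialDiv, pderiv_comp_eq_zero hx]

theorem radialDeriv_eq_zero (hx : x ∉ tsupport ψ) : radialDeriv ψ x = 0 := by
  simp [radialDeriv, pderiv_comp_eq_zero hx]

theorem flux_eq_zero (hx : x ∉ tsupport ψ) (k : Fin 4) : flux ψ k x = 0 := by
  simp [flux, spatialDiv_eq_zero hx, pderiv_comp_eq_zero hx, image_eq_zero_of_notMem_tsupport hx]

theorem sum_spatial_mul_flux (ψ : (Fin 4 → ℝ) → (Fin 4 → ℝ)) (x : Fin 4 → ℝ) :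
    ∑ k, spatial x k * flux ψ k x = radius x ^ 2 * spatialDiv ψ x - radialDeriv ψ x := by
  unfold flux radialDeriv
  generalize spatialDiv ψ x = d
  simp only [Fin.sum_univ_four, radius_sq]
  simp [spatial, dt]
  ring

/-- In the spatial part the second derivatives `x·∇ div ψ` cancel by symmetry, and `3 div ψ - div ψ`
remains. -/
theorem sum_pderiv_flux (hψ : ContDiff ℝ ∞ ψ) (x : Fin 4 → ℝ) :
    ∑ k, pderiv k (flux ψ k) x = 2 * pderiv 0 (fun y => ψ y 0) x + 2 * spatialDiv ψ x := by
  have hg : ∀ {u : (Fin 4 → ℝ) → ℝ}, ContDiff ℝ ∞ u → HasGrad u (fun i => pderiv i u x) x :=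
    fun hu => HasGrad.of_differentiableAt (hu.differentiable (by simp) x)
  have hflux : ∀ k l, pderiv l (flux ψ k) x = _ := fun k l =>
    ((((HasGrad.const (dt k)).mul ((HasGrad.const 2).mul (hg (contDiff_pi.1 hψ 0)))).add
      ((hasGrad_spatial k x).mul (HasGrad.sum fun i => (HasGrad.const (1 - dt i)).mul
        (hg (contDiff_pderiv_comp hψ i i))))).add
      ((HasGrad.const (dt k - 1)).mul (HasGrad.sum fun μ =>
        (hasGrad_spatial μ x).mul (hg (contDiff_pderiv_comp hψ μ k))))).pderiv_eq l
  have hc := fun i j k => pderiv_comm (contDiff_pi.1 hψ k) i j x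
  simp only [hflux]
  simp only [spatialDiv, Fin.sum_univ_four]
  simp [spatial, dt, euclid]
  linear_combination x 1 * hc 1 2 2 + x 1 * hc 1 3 3 + x 2 * hc 2 1 1 + x 2 * hc 2 3 3
    + x 3 * hc 3 1 1 + x 3 * hc 3 2 2

theorem contDiffAt_radial {ζ : ℝ → ℝ} (hζ : ContDiffOn ℝ 1 ζ (Ioi 0)) (hx : 0 < radius x) :
    ContDiffAt ℝ 1 (fun y => ζ (radius y)) x := by
  have h : ContDiffAt ℝ 1 radius x := by
    unfold radius
    refine ContDiffAt.sqrt (by fun_prop) ?_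
    rw [← radius_sq]
    positivity
  exact (hζ.contDiffAt (Ioi_mem_nhds hx)).comp x h

/-- The weak form of the conservation law for a radial coefficient vanishing near the axis. -/
theorem integral_radial_flux_eq_zero (hψ : ContDiff ℝ ∞ ψ) (hs : HasCompactSupport ψ) {ζ : ℝ → ℝ}
    (hζ : ContDiffOn ℝ 1 ζ (Ioi 0)) {δ : ℝ} (hδ : 0 < δ) (h0 : ∀ r, 0 ≤ r → r < δ → ζ r = 0) :
    Integrable (fluxDiv ψ ζ) ∧ ∫ x, fluxDiv ψ ζ x = 0 := by
  -- Across the axis, where the radius is not smooth, the product vanishes identically near the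
  -- point.
  have hu : ∀ k, ContDiff ℝ 1 (fun x => ζ (radius x) * flux ψ k x) := fun k => by
    rw [contDiff_iff_contDiffAt]
    intro x
    rcases (radius_nonneg x).eq_or_lt with hx | hx
    · have : (fun x => ζ (radius x) * flux ψ k x) =ᶠ[𝓝 x] fun _ => 0 := by
        filter_upwards [continuous_radius.continuousAt.eventually
          (gt_mem_nhds (hx ▸ hδ : radius x < δ))] with y hy
        rw [h0 _ (radius_nonneg y) hy, zero_mul]
      exact contDiffAt_const.congr_of_eventuallyEq this
    · exact (contDiffAt_radial hζ hx).mul ((contDiff_flux hψ k).of_le (by simp)).contDiffAt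
  have hsu : ∀ k, HasCompactSupport (fun x => ζ (radius x) * flux ψ k x) := fun k =>
    HasCompactSupport.intro hs fun x hx => by rw [flux_eq_zero hx, mul_zero]
  suffices hae : (fun x => ∑ k, pderiv k (fun x => ζ (radius x) * flux ψ k x) x) =ᵐ[volume]
      fluxDiv ψ ζ by
    refine ⟨(integrable_finsetSum _ fun k _ => integrable_pderiv (hu k) (hsu k) k).congr hae, ?_⟩
    rw [← integral_congr_ae hae, integral_finsetSum _ fun k _ => integrable_pderiv (hu k) (hsu k) k]
    exact Finset.sum_eq_zero fun k _ => integral_pderiv_eq_zero (hu k) (hsu k) k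
  refine ae_radius_pos.mono fun x hx => ?_
  have hd := ((hζ.contDiffAt (Ioi_mem_nhds hx)).differentiableAt one_ne_zero).hasDerivAt
  have hp : ∀ k, pderiv k (fun x => ζ (radius x) * flux ψ k x) x
      = ζ (radius x) * pderiv k (flux ψ k) x
        + deriv ζ (radius x) / radius x * (spatial x k * flux ψ k x) := fun k => by
    rw [((hasGrad_radial hx hd).mul (HasGrad.of_differentiableAt
      ((contDiff_flux hψ k).differentiable (by simp) x))).pderiv_eq k]
    ring
  simp only [hp, Finset.sum_add_distrib, ← Finset.mul_sum, fluxDiv]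
  rw [sum_pderiv_flux hψ, sum_spatial_mul_flux]

end Flux

open Filter

/-! ### Cutoff near the axis. -/

section Cutoff

theorem deriv_smoothTransition_of_neg {t : ℝ} (ht : t < 0) :
    deriv Real.smoothTransition t = 0 := by
  have : Real.smoothTransition =ᶠ[𝓝 t] fun _ => 0 :=
    (gt_mem_nhds ht).mono fun s hs => Real.smoothTransition.zero_of_nonpos (le_of_lt hs)
  rw [this.deriv_eq, deriv_const]

theorem deriv_smoothTransition_of_one_lt {t : ℝ} (ht : 1 < t) :
    deriv Real.smoothTransition t = 0 := by
  have : Real.smoothTransition =ᶠ[𝓝 t] fun _ => 1 :=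
    (lt_mem_nhds ht).mono fun s hs => Real.smoothTransition.one_of_one_le (le_of_lt hs)
  rw [this.deriv_eq, deriv_const]

/-- Differentiating the cutoff produces `(2/r) · s S'(s - 1)`, with `S` the smooth transition and `s
= N r²`. This bound is what makes the estimates uniform in `N`. -/
theorem exists_abs_mul_deriv_smoothTransition_le :
    ∃ M, 0 ≤ M ∧ ∀ s : ℝ, |s * deriv Real.smoothTransition (s - 1)| ≤ M := by
  have hc : Continuous fun s : ℝ => s * deriv Real.smoothTransition (s - 1) :=
    continuous_id.mul (((Real.smoothTransition.contDiff (n := 1)).continuous_deriv le_rfl).comp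
      (continuous_id.sub continuous_const))
  have hs : HasCompactSupport fun s : ℝ => s * deriv Real.smoothTransition (s - 1) := by
    refine HasCompactSupport.intro (isCompact_Icc (a := 1) (b := 2)) fun s hs => ?_
    rw [mem_Icc, not_and_or, not_le, not_le] at hs
    rcases hs with h | h
    · rw [deriv_smoothTransition_of_neg (by linarith), mul_zero]
    · rw [deriv_smoothTransition_of_one_lt (by linarith), mul_zero]
  obtain ⟨M, hM⟩ := hs.exists_bound_of_continuous hc
  exact ⟨M, (norm_nonneg _).trans (hM 0), hM⟩

/-- The function `Z` cut off to vanish for `r² ≤ 1 / N`. -/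
noncomputable def cutoff (Z : ℝ → ℝ) (N r : ℝ) : ℝ := Real.smoothTransition (N * r ^ 2 - 1) * Z r

variable {Z : ℝ → ℝ}

theorem contDiffOn_cutoff (hZ : ContDiffOn ℝ 1 Z (Ioi 0)) (N : ℝ) :
    ContDiffOn ℝ 1 (cutoff Z N) (Ioi 0) :=
  ((Real.smoothTransition.contDiff (n := 1)).comp (by fun_prop :
    ContDiff ℝ 1 fun r : ℝ => N * r ^ 2 - 1)).contDiffOn.mul hZ

/-- For `N ≥ 1`, `N r² ≤ (N r)² < 1`. -/
theorem cutoff_eq_zero {N r : ℝ} (h0 : 0 ≤ r) (hN : 1 ≤ N) (h : r < 1 / N) : cutoff Z N r = 0 := by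
  rw [cutoff, Real.smoothTransition.zero_of_nonpos, zero_mul]
  rw [lt_div_iff₀ (by linarith)] at h
  nlinarith

theorem deriv_cutoff (hZ : ContDiffOn ℝ 1 Z (Ioi 0)) (N : ℝ) {r : ℝ} (hr : 0 < r) :
    deriv (cutoff Z N) r = deriv Real.smoothTransition (N * r ^ 2 - 1) * (2 * N * r) * Z r
      + Real.smoothTransition (N * r ^ 2 - 1) * deriv Z r := by
  have h1 : HasDerivAt (fun r : ℝ => N * r ^ 2 - 1) (2 * N * r) r :=
    (((hasDerivAt_pow 2 r).const_mul N).sub_const 1).congr_deriv (by push_cast; ring)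
  have h2 := ((Real.smoothTransition.contDiff (n := 1)).differentiable one_ne_zero
    (N * r ^ 2 - 1)).hasDerivAt.comp r h1
  exact (h2.mul ((hZ.contDiffAt (Ioi_mem_nhds hr)).differentiableAt one_ne_zero).hasDerivAt).deriv

end Cutoff

/-! ### Removing the cutoff by dominated convergence. -/

section Limit

variable {ψ : (Fin 4 → ℝ) → (Fin 4 → ℝ)} {Z : ℝ → ℝ}

/-- The second summand is the error from differentiating the cutoff, grouped so that, apart from
`Z`, each factor is bounded on the support of `ψ`. -/
theorem fluxDiv_cutoff (hZ : ContDiffOn ℝ 1 Z (Ioi 0)) (N : ℝ) {x : Fin 4 → ℝ}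
    (hx : 0 < radius x) :
    fluxDiv ψ (cutoff Z N) x =
      Real.smoothTransition (N * radius x ^ 2 - 1) * fluxDiv ψ Z x
        + 2 * (N * radius x ^ 2 * deriv Real.smoothTransition (N * radius x ^ 2 - 1))
          * Z (radius x) * ((radius x ^ 2 * spatialDiv ψ x - radialDeriv ψ x) / radius x ^ 2) := by
  rw [fluxDiv, fluxDiv, deriv_cutoff hZ N hx, cutoff]
  field_simp
  ring

/-- At a fixed point the sequence is eventually constant: once `N r² > 2` the cutoff equals `1` near
that radius. -/
theorem tendsto_fluxDiv_cutoff (hZ : ContDiffOn ℝ 1 Z (Ioi 0)) {x : Fin 4 → ℝ}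
    (hx : 0 < radius x) :
    Tendsto (fun n : ℕ => fluxDiv ψ (cutoff Z (n + 1)) x) atTop (𝓝 (fluxDiv ψ Z x)) := by
  refine tendsto_const_nhds.congr' ?_
  obtain ⟨n₀, hn₀⟩ := exists_nat_gt (2 / radius x ^ 2)
  rw [div_lt_iff₀ (by positivity)] at hn₀
  filter_upwards [eventually_ge_atTop n₀] with n hn
  have hn' : (n₀ : ℝ) ≤ n := by exact_mod_cast hn
  have h : 1 < ((n : ℝ) + 1) * radius x ^ 2 - 1 := by
    nlinarith [mul_le_mul_of_nonneg_right hn' (sq_nonneg (radius x)), sq_nonneg (radius x)]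
  rw [fluxDiv_cutoff hZ _ hx, deriv_smoothTransition_of_one_lt h,
    Real.smoothTransition.one_of_one_le h.le]
  ring

theorem exists_abs_pderiv_comp_le (hψ : ContDiff ℝ ∞ ψ) (hs : HasCompactSupport ψ) :
    ∃ P, 0 ≤ P ∧ ∀ i j x, |pderiv i (fun y => ψ y j) x| ≤ P := by
  have h : ∀ i j, ∃ P, ∀ x, ‖pderiv i (fun y => ψ y j) x‖ ≤ P := fun i j =>
    (HasCompactSupport.intro hs fun x hx => pderiv_comp_eq_zero hx i j).exists_bound_of_continuous
      (contDiff_pderiv_comp hψ i j).continuous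
  choose P hP using h
  have h0 : ∀ i j, 0 ≤ P i j := fun i j => (norm_nonneg _).trans (hP i j 0)
  refine ⟨∑ i, ∑ j, P i j, Finset.sum_nonneg fun i _ => Finset.sum_nonneg fun j _ => h0 i j,
    fun i j x => (hP i j x).trans ?_⟩
  exact (Finset.single_le_sum (fun j _ => h0 i j) (Finset.mem_univ j)).trans
    (Finset.single_le_sum (f := fun i => ∑ j, P i j)
      (fun i _ => Finset.sum_nonneg fun j _ => h0 i j) (Finset.mem_univ i))

theorem abs_spatialDiv_le {P : ℝ} {x : Fin 4 → ℝ}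
    (hP : ∀ i j, |pderiv i (fun y => ψ y j) x| ≤ P) : |spatialDiv ψ x| ≤ 4 * P := by
  refine (Finset.abs_sum_le_sum_abs _ _).trans ?_
  have : ∀ i ∈ Finset.univ, |(1 - dt i) * pderiv i (fun y => ψ y i) x| ≤ P := fun i _ => by
    rw [abs_mul]
    refine (mul_le_of_le_one_left (abs_nonneg _) ?_).trans (hP i i)
    unfold dt; split_ifs <;> simp
  simpa using Finset.sum_le_sum this

theorem abs_radialDeriv_le {P : ℝ} {x : Fin 4 → ℝ}
    (hP : ∀ i j, |pderiv i (fun y => ψ y j) x| ≤ P) :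
    |radialDeriv ψ x| ≤ 16 * P * radius x ^ 2 := by
  have : ∀ i j, |spatial x i * spatial x j * pderiv i (fun y => ψ y j) x| ≤ P * radius x ^ 2 := by
    intro i j
    rw [abs_mul, abs_mul, mul_comm, pow_two]
    exact mul_le_mul (hP i j) (mul_le_mul (abs_spatial_le_radius x i) (abs_spatial_le_radius x j)
      (abs_nonneg _) (radius_nonneg x)) (by positivity) ((abs_nonneg _).trans (hP i j))
  calc |radialDeriv ψ x| ≤ ∑ i : Fin 4, ∑ j : Fin 4, P * radius x ^ 2 :=
        (Finset.abs_sum_le_sum_abs _ _).trans <| Finset.sum_le_sum fun i _ =>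
          (Finset.abs_sum_le_sum_abs _ _).trans <| Finset.sum_le_sum fun j _ => this i j
    _ = 16 * P * radius x ^ 2 := by simp; ring

theorem fluxDiv_eq_zero {x : Fin 4 → ℝ} (hx : x ∉ tsupport ψ) : fluxDiv ψ Z x = 0 := by
  simp [fluxDiv, spatialDiv_eq_zero hx, radialDeriv_eq_zero hx, pderiv_comp_eq_zero hx]

/-- The weak form of the conservation law for a radial coefficient with an integrable
singularity on the axis. -/
theorem integral_fluxDiv_eq_zero (hψ : ContDiff ℝ ∞ ψ) (hs : HasCompactSupport ψ)
    (hZ : ContDiffOn ℝ 1 Z (Ioi 0)) {γ : ℝ} (hγ : 0 < γ) (hγ₁ : γ ≤ 1)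
    (hb : ∀ R, ∃ C, ∀ r, 0 < r → r ≤ R →
      |Z r| ≤ C * r ^ (γ - 3) ∧ |r * deriv Z r| ≤ C * r ^ (γ - 3)) :
    Integrable (fluxDiv ψ Z) ∧ ∫ x, fluxDiv ψ Z x = 0 := by
  obtain ⟨R, hR⟩ := hs.isCompact.exists_bound_of_continuousOn continuous_radius.continuousOn
  obtain ⟨C, hC⟩ := hb R
  obtain ⟨P, hP0, hP⟩ := exists_abs_pderiv_comp_le hψ hs
  obtain ⟨M, hM0, hM⟩ := exists_abs_mul_deriv_smoothTransition_le
  -- The constants: `10 = 2 + 2 · 4` bounds the factor of `Z`, `20 = 4 + 16` the factor of `r Z'`,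
  -- and `30` is their sum; the cutoff error adds `2 · M · 20`.
  have hbound : ∀ x ∈ tsupport ψ, 0 < radius x →
      |fluxDiv ψ Z x| ≤ 30 * P * (C * radius x ^ (γ - 3)) ∧
      ∀ N, |fluxDiv ψ (cutoff Z N) x| ≤ (30 * P + 40 * M * P) * (C * radius x ^ (γ - 3)) := by
    intro x hx hr
    obtain ⟨hZ₁, hZ₂⟩ := hC _ hr ((le_abs_self _).trans (hR x hx))
    have hS : |2 * pderiv 0 (fun y => ψ y 0) x + 2 * spatialDiv ψ x| ≤ 10 * P := by
      refine (abs_add_le _ _).trans ?_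
      rw [abs_mul, abs_mul, abs_two]
      linarith [hP 0 0 x, abs_spatialDiv_le (fun i j => hP i j x)]
    have hQ : |(radius x ^ 2 * spatialDiv ψ x - radialDeriv ψ x) / radius x ^ 2| ≤ 20 * P := by
      rw [abs_div, abs_of_pos (by positivity : 0 < radius x ^ 2), div_le_iff₀ (by positivity)]
      refine (abs_sub _ _).trans ?_
      rw [abs_mul, abs_of_pos (by positivity : 0 < radius x ^ 2)]
      nlinarith [abs_radialDeriv_le (fun i j => hP i j x),
        mul_le_mul_of_nonneg_left (abs_spatialDiv_le (fun i j => hP i j x)) (sq_nonneg (radius x))]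
    have hB : 0 ≤ C * radius x ^ (γ - 3) := (abs_nonneg _).trans hZ₁
    have hF : |fluxDiv ψ Z x| ≤ 30 * P * (C * radius x ^ (γ - 3)) := by
      have e : fluxDiv ψ Z x = Z (radius x) * (2 * pderiv 0 (fun y => ψ y 0) x + 2 * spatialDiv ψ x)
          + (radius x * deriv Z (radius x))
            * ((radius x ^ 2 * spatialDiv ψ x - radialDeriv ψ x) / radius x ^ 2) := by
        rw [fluxDiv]; field_simp
      rw [e]
      refine (abs_add_le _ _).trans ?_
      rw [abs_mul, abs_mul]
      linarith [mul_le_mul hZ₁ hS (abs_nonneg _) hB, mul_le_mul hZ₂ hQ (abs_nonneg _) hB]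
    refine ⟨hF, fun N => ?_⟩
    rw [fluxDiv_cutoff hZ N hr]
    refine (abs_add_le _ _).trans ?_
    rw [add_mul]
    refine add_le_add ?_ ?_
    · rw [abs_mul, abs_of_nonneg (Real.smoothTransition.nonneg _)]
      exact (mul_le_of_le_one_left (abs_nonneg _) (Real.smoothTransition.le_one _)).trans hF
    · rw [abs_mul, abs_mul, abs_mul, abs_two]
      have := mul_le_mul (mul_le_mul (mul_le_mul_of_nonneg_left (hM (N * radius x ^ 2)) zero_le_two)
        hZ₁ (abs_nonneg _) (by positivity)) hQ (abs_nonneg _) (by positivity)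
      linarith
  have hg : Integrable ((tsupport ψ).indicator fun x =>
      (30 * P + 40 * M * P) * (C * radius x ^ (γ - 3))) := by
    rw [integrable_indicator_iff hs.isCompact.measurableSet]
    exact ((integrableOn_radius_rpow hγ hγ₁ hs.isCompact).const_mul C).const_mul _
  have hn := fun n : ℕ => integral_radial_flux_eq_zero hψ hs
    (contDiffOn_cutoff hZ ((n : ℝ) + 1)) (δ := 1 / ((n : ℝ) + 1)) (by positivity)
    fun r h0 h => cutoff_eq_zero h0 (by simp) h
  have hdom : ∀ n : ℕ, ∀ᵐ x, ‖fluxDiv ψ (cutoff Z (n + 1)) x‖ ≤ (tsupport ψ).indicator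
      (fun x => (30 * P + 40 * M * P) * (C * radius x ^ (γ - 3))) x := fun n =>
    ae_radius_pos.mono fun x hr => by
      by_cases hx : x ∈ tsupport ψ
      · rw [indicator_of_mem hx]; exact (hbound x hx hr).2 _
      · rw [indicator_of_notMem hx, fluxDiv_eq_zero hx, norm_zero]
  have hlim : ∀ᵐ x, Tendsto (fun n : ℕ => fluxDiv ψ (cutoff Z (n + 1)) x) atTop
      (𝓝 (fluxDiv ψ Z x)) := ae_radius_pos.mono fun x hr => tendsto_fluxDiv_cutoff hZ hr
  refine ⟨hg.mono' (aestronglyMeasurable_of_tendsto_ae _ (fun n => (hn n).1.1) hlim) ?_, ?_⟩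
  · rw [← ae_all_iff] at hdom
    filter_upwards [hdom, hlim] with x hx hl
    exact le_of_tendsto hl.norm (Eventually.of_forall hx)
  · have h := tendsto_integral_of_dominated_convergence _ (fun n => (hn n).1.1) hg hdom hlim
    simp only [(hn _).2] at h
    exact (tendsto_nhds_unique h tendsto_const_nhds)

end Limit

/-! ### Application to the static metric. -/

theorem volDensity_staticMetric {c : ℝ} (hc : 0 < c) {α : ℝ → ℝ} {x : Fin 4 → ℝ}
    (hx : 0 < radius x) : volDensity (staticMetric c α (fun r => -α r)) x = c := by
  rw [volDensity, det_staticMetric (f := fun r => Real.exp (2 * α r)) (fun _ => rfl) hx, abs_neg,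
    abs_of_nonneg (by positivity), Real.sqrt_sq hc.le]

/-- For a static metric with `f = exp (2 α)`, this is `(f - 1 + r f') / (2 r²)`, half the energy
component of the Einstein tensor. -/
noncomputable def halfEnergy (f : ℝ → ℝ) (r : ℝ) : ℝ := (f r - 1 + r * deriv f r) / (2 * r ^ 2)

section

variable {c : ℝ} {α f : ℝ → ℝ}

theorem contDiffOn_deriv_Ioi (hf : ContDiffOn ℝ 2 f (Ioi 0)) :
    ContDiffOn ℝ 1 (deriv f) (Ioi 0) :=
  ((contDiffOn_succ_iff_deriv_of_isOpen (n := 1) isOpen_Ioi).1 hf).2.2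

theorem hasDerivAt_of_contDiffOn {g : ℝ → ℝ} {n : WithTop ℕ∞} (hn : n ≠ 0)
    (hg : ContDiffOn ℝ n g (Ioi 0)) {r : ℝ} (hr : 0 < r) : HasDerivAt g (deriv g r) r :=
  ((hg.contDiffAt (Ioi_mem_nhds hr)).differentiableAt hn).hasDerivAt

theorem contDiffOn_halfEnergy (hf : ContDiffOn ℝ 2 f (Ioi 0)) :
    ContDiffOn ℝ 1 (halfEnergy f) (Ioi 0) :=
  (((hf.of_le (by norm_num)).sub contDiffOn_const).add
    (contDiffOn_id.mul (contDiffOn_deriv_Ioi hf))).div (by fun_prop)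
    fun r (hr : 0 < r) => by positivity

theorem hasDerivAt_energy (hf : ContDiffOn ℝ 2 f (Ioi 0)) {r : ℝ} (hr : 0 < r) :
    HasDerivAt (fun r => f r - 1 + r * deriv f r) (2 * deriv f r + r * deriv (deriv f) r) r :=
  (((hasDerivAt_of_contDiffOn two_ne_zero hf hr).sub_const 1).add ((hasDerivAt_id' r).mul
    (hasDerivAt_of_contDiffOn one_ne_zero (contDiffOn_deriv_Ioi hf) hr))).congr_deriv (by ring)

theorem deriv_halfEnergy (hf : ContDiffOn ℝ 2 f (Ioi 0)) {r : ℝ} (hr : 0 < r) :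
    deriv (halfEnergy f) r = (2 * deriv f r + r * deriv (deriv f) r) / (2 * r ^ 2)
      - (f r - 1 + r * deriv f r) / r ^ 3 := by
  refine (((hasDerivAt_energy hf hr).div ((hasDerivAt_pow 2 r).const_mul 2)
    (by positivity)).congr_deriv ?_).deriv
  field_simp
  push_cast
  ring

/-- For `Z = E/(2r²)` the coefficients agree: `2Z = E/r²` for `∂₀ψ⁰`, `2Z + r Z' = E'/(2r)` for the
spatial divergence, and `-Z'/r = E/r⁴ - E'/(2r³)` for the radial term. -/
theorem einstein_contraction_eq_fluxDiv (hc : 0 < c) (hf : ∀ r, f r = Real.exp (2 * α r))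
    (hf₂ : ContDiffOn ℝ 2 f (Ioi 0)) (ψ : (Fin 4 → ℝ) → (Fin 4 → ℝ)) {x : Fin 4 → ℝ}
    (hx : 0 < radius x) :
    (∑ μ, ∑ ν, einstein (staticMetric c α (fun r => -α r)) μ ν x *
        covDeriv (staticMetric c α (fun r => -α r)) ψ μ ν x) *
      volDensity (staticMetric c α (fun r => -α r)) x = c * fluxDiv ψ (halfEnergy f) x := by
  have hd : spatialDiv ψ x = pderiv 1 (fun y => ψ y 1) x + pderiv 2 (fun y => ψ y 2) x
      + pderiv 3 (fun y => ψ y 3) x := by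
    simp [spatialDiv, dt, Fin.sum_univ_four]
  rw [volDensity_staticMetric hc hx, einstein_contraction_staticMetric hc.ne' hf
    (fun r hr => hasDerivAt_of_contDiffOn two_ne_zero hf₂ hr)
    (fun r hr => hasDerivAt_of_contDiffOn one_ne_zero (contDiffOn_deriv_Ioi hf₂) hr) hx,
    ← hd, ← radialDeriv, fluxDiv, deriv_halfEnergy hf₂ hx, halfEnergy]
  field_simp
  ring

end

/-- The weak Bianchi identity for a static metric whose energy density is bounded, together with
its derivative, by an integrable power of the radius. -/
theorem weakSecondBianchi_staticMetric {c : ℝ} (hc : 0 < c) {α f : ℝ → ℝ}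
    (hf : ∀ r, f r = Real.exp (2 * α r)) (hf₂ : ContDiffOn ℝ 2 f (Ioi 0)) {γ : ℝ} (hγ : 0 < γ)
    (hγ₁ : γ ≤ 1) (hdecay : IsBigOWithDerivs 1 (fun r => f r - 1 + r * deriv f r) (-1 + γ)) :
    WeakSecondBianchi (staticMetric c α (fun r => -α r)) := by
  intro ψ hψ hs
  have hE : ContDiffOn ℝ 1 (fun r => f r - 1 + r * deriv f r) (Ioi 0) :=
    ((hf₂.of_le (by norm_num)).sub contDiffOn_const).add
      (contDiffOn_id.mul (contDiffOn_deriv_Ioi hf₂))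
  have hpow : ∀ a : ℝ, ContinuousOn (fun r : ℝ => r ^ a) (Ioi 0) := fun a r hr =>
    (Real.continuousAt_rpow_const r a (Or.inl (ne_of_gt hr))).continuousWithinAt
  have hb : ∀ R, ∃ C, ∀ r, 0 < r → r ≤ R →
      |halfEnergy f r| ≤ C * r ^ (γ - 3) ∧ |r * deriv (halfEnergy f) r| ≤ C * r ^ (γ - 3) := by
    intro R
    obtain ⟨C₀, hC₀, h₀⟩ := exists_abs_le_of_isBigO_one
      (by simpa only [iteratedDeriv_zero] using! (hpow _).mul hE.continuousOn)
      (hdecay 0 zero_le_one) R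
    obtain ⟨C₁, hC₁, h₁⟩ := exists_abs_le_of_isBigO_one
      (by simpa only [iteratedDeriv_one] using!
        (hpow _).mul (hE.continuousOn_deriv_of_isOpen isOpen_Ioi le_rfl))
      (hdecay 1 le_rfl) R
    refine ⟨C₀ + C₁, fun r hr hrR => ?_⟩
    specialize h₀ r hr hrR
    specialize h₁ r hr hrR
    rw [iteratedDeriv_zero, abs_mul, abs_of_pos (Real.rpow_pos_of_pos hr _)] at h₀
    rw [iteratedDeriv_one, (hasDerivAt_energy hf₂ hr).deriv, abs_mul,
      abs_of_pos (Real.rpow_pos_of_pos hr _)] at h₁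
    -- Rewriting the weights turns the decay hypotheses into `|E|/r² ≤ C₀ r^(γ-3)` and `|E'|/r ≤ C₁
    -- r^(γ-3)`.
    have e₀ : r ^ (((0 : ℕ) : ℝ) - (-1 + γ)) = (r ^ (γ - 3))⁻¹ / r ^ 2 := by
      rw [← Real.rpow_neg hr.le, ← Real.rpow_natCast r 2, ← Real.rpow_sub hr]
      congr 1; push_cast; ring
    have e₁ : r ^ (((1 : ℕ) : ℝ) - (-1 + γ)) = (r ^ (γ - 3))⁻¹ / r := by
      rw [← Real.rpow_neg hr.le]
      nth_rw 3 [← Real.rpow_one r]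
      rw [← Real.rpow_sub hr]
      congr 1; push_cast; ring
    have hp : 0 < r ^ (γ - 3) := Real.rpow_pos_of_pos hr _
    rw [e₀] at h₀
    rw [e₁] at h₁
    rw [deriv_halfEnergy hf₂ hr, halfEnergy]
    generalize f r - 1 + r * deriv f r = E at *
    generalize 2 * deriv f r + r * deriv (deriv f) r = E' at *
    generalize r ^ (γ - 3) = p at *
    have k₀ : |E / r ^ 2| ≤ C₀ * p := by
      rw [abs_div, abs_of_pos (by positivity : 0 < r ^ 2)]
      calc |E| / r ^ 2 = p⁻¹ / r ^ 2 * |E| * p := by field_simp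
        _ ≤ C₀ * p := mul_le_mul_of_nonneg_right h₀ hp.le
    have k₁ : |E' / r| ≤ C₁ * p := by
      rw [abs_div, abs_of_pos hr]
      calc |E'| / r = p⁻¹ / r * |E'| * p := by field_simp
        _ ≤ C₁ * p := mul_le_mul_of_nonneg_right h₁ hp.le
    have q₀ : E / (2 * r ^ 2) = E / r ^ 2 / 2 := by field_simp
    -- Both `Z` and `r Z' = E'/(2r) - E/r²` are therefore controlled by `C₀ + C₁`.
    have q₁ : r * (E' / (2 * r ^ 2) - E / r ^ 3) = E' / r / 2 - E / r ^ 2 := by field_simp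
    rw [q₀, q₁]
    have := mul_nonneg hC₀ hp.le
    have := mul_nonneg hC₁ hp.le
    rw [abs_le] at k₀ k₁ ⊢
    rw [abs_le]
    constructor <;> constructor <;> linarith
  obtain ⟨hi, h0⟩ := integral_fluxDiv_eq_zero hψ hs (contDiffOn_halfEnergy hf₂) hγ hγ₁ hb
  have hae : (fun x => c * fluxDiv ψ (halfEnergy f) x) =ᵐ[volume] _ :=
    ae_radius_pos.mono fun x hx => (einstein_contraction_eq_fluxDiv hc hf hf₂ ψ hx).symm
  refine ⟨(hi.const_mul c).congr hae, ?_⟩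
  rw [← integral_congr_ae hae, integral_const_mul, h0, mul_zero]

theorem IsBigOWithDerivs.congr_const_mul {k : ℕ} {f g : ℝ → ℝ} {a b : ℝ}
    (h : IsBigOWithDerivs k f a) (hfg : ∀ r, 0 < r → g r = b * f r) :
    IsBigOWithDerivs k g a := by
  intro j hj
  refine ((h j hj).const_mul_left b).congr' ?_ EventuallyEq.rfl
  filter_upwards [self_mem_nhdsWithin] with r hr
  have he : g =ᶠ[𝓝 r] fun s => b * f s := (lt_mem_nhds hr).mono fun s hs => hfg s hs
  rw [he.iteratedDeriv_eq, iteratedDeriv_const_mul_field]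
  ring

end LorentzR4

theorem corollary2p4 (G c : ℝ) (hG : 0 < G) (hc : 0 < c) (α m : ℝ → ℝ)
    (hα : ContDiffOn ℝ 2 α (Set.Ioi 0))
    (hm : ∀ r : ℝ, 0 < r → Real.exp (2 * α r) = 1 - 2 * G * m r / (c ^ 2 * r))
    (γ : ℝ) (hγ : 0 < γ)
    (hdecay : LorentzR4.IsBigOWithDerivs 1 (deriv m) (-1 + γ)) :
    LorentzR4.WeakSecondBianchi (LorentzR4.staticMetric c α (fun r => -α r)) := by
  have hf₂ : ContDiffOn ℝ 2 (fun r => Real.exp (2 * α r)) (Set.Ioi 0) :=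
    (contDiffOn_const.mul hα).exp
  -- Lowering `γ` weakens the decay assumption, so `γ` may be replaced by `min γ 1`, which keeps the
  -- exponent `γ - 3` negative. The factor `-(2G/c²)` comes from `r (f - 1) = -(2G/c²) m`,
  -- differentiated once.
  refine LorentzR4.weakSecondBianchi_staticMetric hc (fun _ => rfl) hf₂ (lt_min hγ one_pos)
    (min_le_right _ _) ((hdecay.mono (b := -1 + min γ 1) ?_).congr_const_mul
      (b := -(2 * G / c ^ 2)) fun r hr => ?_)
  · linarith [min_le_left γ 1]
  -- Solving the defining relation for `m` near `r` also supplies its differentiability.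
  have he : m =ᶠ[𝓝 r] fun s => c ^ 2 / (2 * G) * (s * (1 - Real.exp (2 * α s))) :=
    (lt_mem_nhds hr).mono fun s (hs : 0 < s) => by
      simp only [hm s hs]
      field_simp
      ring
  have hd := LorentzR4.hasDerivAt_of_contDiffOn two_ne_zero hf₂ hr
  have hp : HasDerivAt (fun s => c ^ 2 / (2 * G) * (s * (1 - Real.exp (2 * α s)))) _ r :=
    ((hasDerivAt_id' r).mul (hd.const_sub 1)).const_mul (c ^ 2 / (2 * G))
  rw [he.deriv_eq, hp.deriv]
  field_simp
  ring
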